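/- Let $A_1,\dots,A_d$ be complex $D\times D$ matrices, and for $N\ge 1$ let $$|\psi_N(A)\rangle=\sum_{i_1,\dots,i_N=1}^d \operatorname{tr}(A_{i_1}\cdots A_{i_N})\,|i_1\cdots i_N\rangle\in(\mathbb{C}^d)^{\otimes N}$$ be the (unnormalized) translation-invariant matrix product state on a ring of $N$ sites represented by them. Let $\rho$ be the spectral radius of the completely positive map $\mathcal{E}(X)=\sum_i A_iXA_i^\dagger$ on complex $D\times D$ matrices. Then there are a real number $c>0$, with $c=\sqrt{\rho}$ if $\rho\neq 0$ (so $c=1$ if the matrices are normalized such that $\rho=1$), finitely many blocks $j=1,\dots,b$ of sizes $n_j\ge 1$ with $\sum_j n_j\le D$, real numbers $0<\lambda_j\le 1$ and complex $n_j\times n_j$ matrices $A_1^j,\dots,A_d^j$ such that, with the block-diagonal matrices $\tilde A_i=\bigoplus_j\lambda_jA_i^j$ (whose size is at most $D$), $$|\psi_N(A)\rangle=c^N\,|\psi_N(\tilde A)\rangle\qquad\text{for every } N\ge 1,$$ and every block $j$ satisfies: 1. $\sum_i A_i^jA_i^{j\dagger}=\mathbb{1}$; 2. $\sum_i A_i^{j\dagger}\Lambda^jA_i^j=\Lambda^j$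 for some diagonal positive full-rank matrix $\Lambda^j$; 3. $\mathbb{1}$ is, up to scalar multiples, the only fixed point of $\mathcal{E}_j(X)=\sum_i A_i^jXA_i^{j\dagger}$. Here $b=0$ is allowed; the empty direct sum represents the zero vector. -/

import Mathlib

namespace MPS

/-- The (unnormalized) translation-invariant matrix product vector
`∑ tr (A_{i₁} ⋯ A_{i_N}) |i₁ ⋯ i_N⟩` on a ring of `N` sites of dimension `d`. A vector of
`(ℂ^d)^{⊗ N}` is given by its coordinates in the product basis, which is indexed by
`Fin N → Fin d`. -/
def tiVector {d : ℕ} {m : Type*} [Fintype m] [DecidableEq m] (A : Fin d → Matrix m m ℂ) (N : ℕ) :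
    (Fin N → Fin d) → ℂ :=
  fun s => ((List.ofFn fun k => A (s k)).prod).trace

/-- The completely positive map `X ↦ ∑ i, A_i X A_i†`. -/
def cpMap {d : ℕ} {m : Type*} [Fintype m] (A : Fin d → Matrix m m ℂ) :
    Module.End ℂ (Matrix m m ℂ) where
  toFun X := ∑ i, A i * X * (A i).conjTranspose
  map_add' X Y := by simp [Matrix.mul_add, Matrix.add_mul, Finset.sum_add_distrib]
  map_smul' c X := by simp [Finset.smul_sum]

/-- The three conditions on a block of the canonical form: the block is unital, the dual map has a
diagonal, positive, full-rank fixed point, and the identity is, up to scalar multiples, the only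
fixed point of the completely positive map of the block. -/
structure IsCanonicalBlock {d : ℕ} {m : Type*} [Fintype m] [DecidableEq m]
    (A : Fin d → Matrix m m ℂ) : Prop where
  unital : ∑ i, A i * (A i).conjTranspose = 1
  dual_fixed : ∃ v : m → ℝ, (∀ k, 0 < v k) ∧
    ∑ i, (A i).conjTranspose * Matrix.diagonal (fun k => (v k : ℂ)) * A i =
      Matrix.diagonal (fun k => (v k : ℂ))
  fixed_unique : ∀ X : Matrix m m ℂ, cpMap A X = X → ∃ z : ℂ, X = z • (1 : Matrix m m ℂ)

/-- The block-diagonal matrices `⊕ⱼ λⱼ Aⱼ_i`. -/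
def blockSum {d b : ℕ} (n : Fin b → ℕ) (lam : Fin b → ℝ)
    (B : (j : Fin b) → Fin d → Matrix (Fin (n j)) (Fin (n j)) ℂ) (i : Fin d) :
    Matrix ((j : Fin b) × Fin (n j)) ((j : Fin b) × Fin (n j)) ℂ :=
  Matrix.blockDiagonal' fun j => (lam j : ℂ) • B j i

end MPS

open scoped ComplexOrder Matrix

namespace MPS

section

variable {d : ℕ} {m k l : Type*} [Fintype m] [Fintype k] [Fintype l]

/-! ### The completely positive map and its spectrum -/

/-! The proof is by induction on `D`. A common invariant subspace makes the family block upper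
triangular in an adapted basis. The trace of a product then sees only the diagonal blocks, so the
vector is the sum of those of two smaller families, and one ends with irreducible families.

For a nonzero irreducible family, Perron–Frobenius (`IsIrreducible.exists_posDef_eigenvector`) gives
a positive definite `X` with `cpMap A X = r X`, `r > 0`. Writing `X = T T†`, conjugating by `T` and
dividing by `√r` makes the family unital. The dual map then has a positive definite fixed point,
which a unitary conjugation diagonalizes. Schur's lemma gives uniqueness of the fixed point
(`IsIrreducible.fixed_unique`).

The weights are `√r`. Each `r` is an eigenvalue of the map of a diagonal block, and passing to
invariant subspaces or quotients only shrinks the spectrum, so `r ≤ ρ`. Dividing the weights by `c =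
√ρ` brings them into `(0, 1]`. -/

theorem cpMap_apply (A : Fin d → Matrix m m ℂ) (X : Matrix m m ℂ) :
    cpMap A X = ∑ i, A i * X * (A i)ᴴ := rfl

theorem mem_spectrum_cpMap_iff (A : Fin d → Matrix m m ℂ) (z : ℂ) :
    z ∈ spectrum ℂ (cpMap A) ↔ ∃ X, X ≠ 0 ∧ cpMap A X = z • X := by
  rw [← Module.End.hasEigenvalue_iff_mem_spectrum]
  constructor
  · intro h
    obtain ⟨X, hX⟩ := h.exists_hasEigenvector
    exact ⟨X, hX.2, hX.apply_eq_smul⟩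
  · rintro ⟨X, hX, h⟩
    exact Module.End.hasEigenvalue_of_hasEigenvector
      ⟨Module.End.mem_eigenspace_iff.2 h, hX⟩

/-! ### Irreducible families -/

/-- A family of matrices is irreducible if it has no nontrivial common invariant subspace. -/
def IsIrreducible (A : Fin d → Matrix m m ℂ) : Prop :=
  ∀ W : Submodule ℂ (m → ℂ), (∀ i, ∀ v ∈ W, A i *ᵥ v ∈ W) → W = ⊥ ∨ W = ⊤

/-- The orthogonal complement of a subspace invariant under the adjoints is invariant under the
family. -/
theorem IsIrreducible.conjTranspose {A : Fin d → Matrix m m ℂ} (hA : IsIrreducible A) :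
    IsIrreducible fun i => (A i)ᴴ := by
  intro W hW
  let e := (WithLp.linearEquiv 2 ℂ (m → ℂ))
  let K : Submodule ℂ (EuclideanSpace ℂ m) := W.comap e.toLinearMap
  have hK : ∀ x, x ∈ K ↔ e x ∈ W := fun x => Iff.rfl
  have key := hA (Kᗮ.comap e.symm.toLinearMap) (by
    intro i v hv
    rw [Submodule.mem_comap, Submodule.mem_orthogonal] at hv ⊢
    intro u hu
    have := hv (e.symm ((A i)ᴴ *ᵥ e u)) (by
      rw [hK, LinearEquiv.apply_symm_apply]; exact hW i _ hu)
    rw [EuclideanSpace.inner_eq_star_dotProduct] at this ⊢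
    change v ⬝ᵥ star ((A i)ᴴ *ᵥ u.ofLp) = 0 at this
    change (A i *ᵥ v) ⬝ᵥ star u.ofLp = 0
    rw [Matrix.star_mulVec, Matrix.conjTranspose_conjTranspose, dotProduct_comm,
      ← Matrix.dotProduct_mulVec, dotProduct_comm] at this
    exact this)
  rcases key with h | h
  · right
    have : Kᗮ = ⊥ := by
      rw [eq_bot_iff]
      intro x hx
      have : e x ∈ Kᗮ.comap e.symm.toLinearMap := by simpa using hx
      rw [h, Submodule.mem_bot] at this
      simpa using this
    rw [Submodule.orthogonal_eq_bot_iff] at this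
    rw [eq_top_iff]
    intro x _
    have hx : e.symm x ∈ K := by rw [this]; trivial
    simpa [hK] using hx
  · left
    have : Kᗮ = ⊤ := by
      rw [eq_top_iff]
      intro x _
      have : e x ∈ Kᗮ.comap e.symm.toLinearMap := by rw [h]; trivial
      simpa using this
    rw [Submodule.orthogonal_eq_top_iff] at this
    rw [eq_bot_iff]
    intro x hx
    have hx : e.symm x ∈ K := by simpa [hK] using hx
    rw [this] at hx
    simpa using hx

variable [DecidableEq k] [DecidableEq l]

/-- A family restricted to an invariant subspace has its spectrum in that of the whole family. -/
theorem spectrum_cpMap_subset_of_injective {A : Fin d → Matrix m m ℂ} {P : Fin d → Matrix k k ℂ}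
    {V : Matrix m k ℂ} {V' : Matrix k m ℂ} (hV : V' * V = 1) (h : ∀ i, A i * V = V * P i) :
    spectrum ℂ (cpMap P) ⊆ spectrum ℂ (cpMap A) := by
  intro z hz
  rw [mem_spectrum_cpMap_iff] at hz ⊢
  obtain ⟨X, hX, hz⟩ := hz
  refine ⟨V * X * Vᴴ, fun h0 => hX ?_, ?_⟩
  · calc X = (V' * V) * X * (V' * V)ᴴ := by simp [hV]
      _ = V' * (V * X * Vᴴ) * V'ᴴ := by simp only [Matrix.conjTranspose_mul, Matrix.mul_assoc]
      _ = 0 := by simp [h0]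
  · calc cpMap A (V * X * Vᴴ) = ∑ i, (A i * V) * X * (A i * V)ᴴ := by
          simp only [cpMap_apply, Matrix.conjTranspose_mul, Matrix.mul_assoc]
      _ = V * cpMap P X * Vᴴ := by
          simp only [h, cpMap_apply, Matrix.conjTranspose_mul, Matrix.mul_assoc, Matrix.mul_sum,
            Matrix.sum_mul]
      _ = _ := by rw [hz]; simp

/-- A family induced on a quotient by an invariant subspace has its spectrum in that of the whole
family. -/
theorem spectrum_cpMap_subset_of_surjective {A : Fin d → Matrix m m ℂ} {R : Fin d → Matrix l l ℂ}
    {W : Matrix l m ℂ} {W' : Matrix m l ℂ} (hW : W * W' = 1) (h : ∀ i, W * A i = R i * W) :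
    spectrum ℂ (cpMap R) ⊆ spectrum ℂ (cpMap A) := by
  intro z hz hu
  refine hz ?_
  have hu' : IsUnit (algebraMap ℂ (Module.End ℂ (Matrix m m ℂ)) z - cpMap A) := hu
  rw [Module.End.isUnit_iff] at hu'
  change IsUnit (algebraMap ℂ (Module.End ℂ (Matrix l l ℂ)) z - cpMap R)
  -- Surjectivity of `z - cpMap A` descends to the quotient, and in finite dimension it already
  -- gives invertibility.
  rw [LinearMap.isUnit_iff_range_eq_top, LinearMap.range_eq_top]
  intro Y
  obtain ⟨X, hX⟩ := hu'.2 (W' * Y * W'ᴴ)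
  refine ⟨W * X * Wᴴ, ?_⟩
  have e : cpMap R (W * X * Wᴴ) = W * cpMap A X * Wᴴ := by
    calc cpMap R (W * X * Wᴴ) = ∑ i, (R i * W) * X * (R i * W)ᴴ := by
          simp only [cpMap_apply, Matrix.conjTranspose_mul, Matrix.mul_assoc]
      _ = _ := by
          simp only [← h, cpMap_apply, Matrix.conjTranspose_mul, Matrix.mul_assoc, Matrix.mul_sum,
            Matrix.sum_mul]
  have hX' : z • X - cpMap A X = W' * Y * W'ᴴ := hX
  calc z • (W * X * Wᴴ) - cpMap R (W * X * Wᴴ) = W * (z • X - cpMap A X) * Wᴴ := by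
        rw [e]; simp [Matrix.mul_sub, Matrix.sub_mul]
    _ = (W * W') * Y * (W * W')ᴴ := by
        rw [hX']; simp only [Matrix.conjTranspose_mul, Matrix.mul_assoc]
    _ = Y := by simp [hW]

variable [DecidableEq m]

/-! ### Matrix product vectors under similarity and block triangular form -/

theorem tiVector_apply (A : Fin d → Matrix m m ℂ) (N : ℕ) (s : Fin N → Fin d) :
    tiVector A N s = (((List.ofFn s).map A).prod).trace := by
  simp [tiVector, List.map_ofFn, Function.comp_def]

theorem prod_map_similar (c : ℂ) (B : Fin d → Matrix k k ℂ) (S : Matrix m k ℂ) (S' : Matrix k m ℂ)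
    (h : S * S' = 1) (h' : S' * S = 1) (L : List (Fin d)) :
    (L.map fun i => c • (S * B i * S')).prod = c ^ L.length • (S * (L.map B).prod * S') := by
  induction L with
  | nil => simp [h]
  | cons a L ih =>
    rw [List.map_cons, List.prod_cons, ih, List.map_cons, List.prod_cons, List.length_cons,
      Matrix.smul_mul, Matrix.mul_smul, smul_smul, pow_succ']
    congr 1
    calc S * B a * S' * (S * (L.map B).prod * S')
        = S * B a * (S' * S) * (L.map B).prod * S' := by simp only [Matrix.mul_assoc]
      _ = _ := by rw [h']; simp only [Matrix.mul_assoc, Matrix.one_mul]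

theorem tiVector_similar {A : Fin d → Matrix m m ℂ} {c : ℂ} {B : Fin d → Matrix k k ℂ}
    {S : Matrix m k ℂ} {S' : Matrix k m ℂ} (h : S * S' = 1) (h' : S' * S = 1)
    (hA : ∀ i, A i = c • (S * B i * S')) (N : ℕ) (s : Fin N → Fin d) :
    tiVector A N s = c ^ N * tiVector B N s := by
  rw [tiVector_apply, tiVector_apply, funext hA, prod_map_similar c B S S' h h', Matrix.trace_smul,
    Matrix.trace_mul_cycle, h', Matrix.one_mul, List.length_ofFn, smul_eq_mul]

theorem prod_map_fromBlocks (P : Fin d → Matrix k k ℂ) (Q : Fin d → Matrix k l ℂ)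
    (R : Fin d → Matrix l l ℂ) (L : List (Fin d)) :
    ∃ X, (L.map fun i => Matrix.fromBlocks (P i) (Q i) 0 (R i)).prod =
      Matrix.fromBlocks (L.map P).prod X 0 (L.map R).prod := by
  induction L with
  | nil => exact ⟨0, by simp⟩
  | cons a L ih =>
    obtain ⟨X, hX⟩ := ih
    refine ⟨P a * X + Q a * (L.map R).prod, ?_⟩
    simp only [List.map_cons, List.prod_cons, hX, Matrix.fromBlocks_multiply]
    simp

theorem tiVector_fromBlocks (P : Fin d → Matrix k k ℂ) (Q : Fin d → Matrix k l ℂ)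
    (R : Fin d → Matrix l l ℂ) (N : ℕ) (s : Fin N → Fin d) :
    tiVector (fun i => Matrix.fromBlocks (P i) (Q i) 0 (R i)) N s =
      tiVector P N s + tiVector R N s := by
  obtain ⟨X, hX⟩ := prod_map_fromBlocks P Q R (List.ofFn s)
  rw [tiVector_apply, hX, tiVector_apply, tiVector_apply]
  simp [Matrix.trace, Fintype.sum_sum_type]

theorem tiVector_blockSum {b : ℕ} (n : Fin b → ℕ) (lam : Fin b → ℝ)
    (B : (j : Fin b) → Fin d → Matrix (Fin (n j)) (Fin (n j)) ℂ) (N : ℕ) (s : Fin N → Fin d) :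
    tiVector (blockSum n lam B) N s = ∑ j, (lam j : ℂ) ^ N * tiVector (B j) N s := by
  have key : ∀ L : List (Fin d), (L.map (blockSum n lam B)).prod =
      Matrix.blockDiagonal' fun j => (L.map fun i => (lam j : ℂ) • B j i).prod := by
    intro L
    induction L with
    | nil => exact (Matrix.blockDiagonal'_one (α := ℂ) (m' := fun j => Fin (n j))).symm
    | cons a L ih =>
      simp only [List.map_cons, List.prod_cons, ih, blockSum]
      rw [Matrix.blockDiagonal'_mul]
  rw [tiVector_apply, key, Matrix.trace_blockDiagonal']
  refine Finset.sum_congr rfl fun j _ => ?_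
  rw [← tiVector_similar (A := fun i => (lam j : ℂ) • B j i) (c := lam j) (B := B j)
    (S := 1) (S' := 1) (by simp) (by simp) (by simp), tiVector_apply]

theorem IsIrreducible.of_similar {A : Fin d → Matrix m m ℂ} (hA : IsIrreducible A) {c : ℂ}
    {B : Fin d → Matrix m m ℂ} {S S' : Matrix m m ℂ} (h : S * S' = 1)
    (hAB : ∀ i, A i = c • (S * B i * S')) : IsIrreducible B := by
  have h' : S' * S = 1 := mul_eq_one_comm.1 h
  intro W hW
  have hS' : ∀ v, S' *ᵥ (S *ᵥ v) = v := fun v => by rw [Matrix.mulVec_mulVec, h', Matrix.one_mulVec]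
  have hS : ∀ v, S *ᵥ (S' *ᵥ v) = v := fun v => by rw [Matrix.mulVec_mulVec, h, Matrix.one_mulVec]
  rcases hA (W.comap (Matrix.toLin' S')) (by
    intro i v hv
    rw [Submodule.mem_comap, Matrix.toLin'_apply] at hv ⊢
    rw [hAB, Matrix.smul_mulVec, Matrix.mulVec_smul, ← Matrix.mulVec_mulVec,
      ← Matrix.mulVec_mulVec, hS']
    exact W.smul_mem _ (hW i _ hv)) with h | h
  · left
    rw [eq_bot_iff]
    intro v hv
    have : S *ᵥ v ∈ W.comap (Matrix.toLin' S') := by simpa [hS'] using hv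
    rw [h, Submodule.mem_bot] at this
    rw [Submodule.mem_bot, ← hS' v, this, Matrix.mulVec_zero]
  · right
    rw [eq_top_iff]
    intro v _
    have : S *ᵥ v ∈ W.comap (Matrix.toLin' S') := by rw [h]; trivial
    simpa [hS'] using this

/-- Schur's lemma. -/
theorem IsIrreducible.eq_smul_one_of_commute {A : Fin d → Matrix m m ℂ} (hA : IsIrreducible A)
    {X : Matrix m m ℂ} (hX : ∀ i, X * A i = A i * X) : ∃ z : ℂ, X = z • (1 : Matrix m m ℂ) := by
  cases isEmpty_or_nonempty m
  · exact ⟨0, Subsingleton.elim _ _⟩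
  obtain ⟨z, hz⟩ := Module.End.exists_eigenvalue (Matrix.toLin' X)
  refine ⟨z, ?_⟩
  rcases hA (Module.End.eigenspace (Matrix.toLin' X) z) (by
    intro i v hv
    rw [Module.End.mem_eigenspace_iff, Matrix.toLin'_apply] at hv ⊢
    rw [Matrix.mulVec_mulVec, hX, ← Matrix.mulVec_mulVec, hv, Matrix.mulVec_smul]) with h | h
  · exact absurd h hz
  · apply Matrix.toLin'.injective
    ext1 v
    ext1
    have : ∀ v, X *ᵥ v = z • v := fun v => by
      have : v ∈ Module.End.eigenspace (Matrix.toLin' X) z := by rw [h]; trivial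
      simpa using Module.End.mem_eigenspace_iff.1 this
    simp only [LinearMap.comp_apply, Matrix.toLin'_apply, this, Matrix.smul_mulVec,
      Matrix.one_mulVec]

end

section

variable {d : ℕ} {m : Type*} [Fintype m]

/-! ### A Perron–Frobenius theorem for irreducible completely positive maps -/

theorem posSemidef_cpMap (A : Fin d → Matrix m m ℂ) {X : Matrix m m ℂ} (hX : X.PosSemidef) :
    (cpMap A X).PosSemidef := by
  rw [cpMap_apply]
  exact Matrix.posSemidef_sum _ fun i _ => hX.mul_mul_conjTranspose_same (A i)

theorem mulVec_eq_zero_of_add {X Y : Matrix m m ℂ} (hX : X.PosSemidef) (hY : Y.PosSemidef)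
    {v : m → ℂ} (h : (X + Y) *ᵥ v = 0) : X *ᵥ v = 0 ∧ Y *ᵥ v = 0 := by
  have h0 : star v ⬝ᵥ X *ᵥ v + star v ⬝ᵥ Y *ᵥ v = 0 := by
    rw [← dotProduct_add, ← Matrix.add_mulVec, h, dotProduct_zero]
  rw [add_eq_zero_iff_of_nonneg (hX.dotProduct_mulVec_nonneg v)
    (hY.dotProduct_mulVec_nonneg v)] at h0
  exact ⟨(hX.dotProduct_mulVec_zero_iff v).1 h0.1, (hY.dotProduct_mulVec_zero_iff v).1 h0.2⟩

/-- The form of `cpMap A X` at `v` is the sum of the nonnegative values of the form of `X` at the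
vectors `(A i)ᴴ *ᵥ v`, so all of them vanish. -/
theorem mulVec_conjTranspose_eq_zero_of_cpMap {A : Fin d → Matrix m m ℂ} {X : Matrix m m ℂ}
    (hX : X.PosSemidef) {v : m → ℂ} (h : cpMap A X *ᵥ v = 0) (i : Fin d) :
    X *ᵥ ((A i)ᴴ *ᵥ v) = 0 := by
  have e : ∀ j, star v ⬝ᵥ ((A j * X * (A j)ᴴ) *ᵥ v) =
      star ((A j)ᴴ *ᵥ v) ⬝ᵥ X *ᵥ ((A j)ᴴ *ᵥ v) := by
    intro j
    rw [Matrix.star_mulVec, Matrix.conjTranspose_conjTranspose, ← Matrix.dotProduct_mulVec,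
      Matrix.mulVec_mulVec, Matrix.mulVec_mulVec, Matrix.mul_assoc]
  have h0 : ∑ j, star ((A j)ᴴ *ᵥ v) ⬝ᵥ X *ᵥ ((A j)ᴴ *ᵥ v) = 0 := by
    simp only [← e]
    rw [← dotProduct_sum, ← Matrix.sum_mulVec, ← cpMap_apply, h, dotProduct_zero]
  rw [Finset.sum_eq_zero_iff_of_nonneg fun j _ => hX.dotProduct_mulVec_nonneg _] at h0
  exact (hX.dotProduct_mulVec_zero_iff _).1 (h0 i (Finset.mem_univ i))

/-- A nonzero positive semidefinite matrix whose kernel is not enlarged by an irreducible completely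
positive map is positive definite. -/
theorem IsIrreducible.posDef_of_ker_le {A : Fin d → Matrix m m ℂ} (hA : IsIrreducible A)
    {X : Matrix m m ℂ} (hX : X.PosSemidef) (h0 : X ≠ 0)
    (hker : ∀ v, X *ᵥ v = 0 → cpMap A X *ᵥ v = 0) : X.PosDef := by
  rcases hA.conjTranspose (LinearMap.ker X.mulVecLin) (by
    intro i v hv
    rw [LinearMap.mem_ker, Matrix.mulVecLin_apply] at hv ⊢
    exact mulVec_conjTranspose_eq_zero_of_cpMap hX (hker v hv) i) with h | h
  · refine .of_dotProduct_mulVec_pos hX.1 fun v hv => ?_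
    refine (hX.dotProduct_mulVec_nonneg v).lt_of_ne' fun h' => hv ?_
    have : v ∈ LinearMap.ker X.mulVecLin := (hX.dotProduct_mulVec_zero_iff v).1 h'
    rwa [h, Submodule.mem_bot] at this
  · classical
    refine absurd ?_ h0
    rw [LinearMap.ker_eq_top] at h
    exact Matrix.ext_of_mulVec_single fun i => by
      rw [← Matrix.mulVecLin_apply, h, LinearMap.zero_apply, Matrix.zero_mulVec]

/-- The kernels of `(1 + cpMap A) ^ n` applied to `Z` decrease with `n`, hence stabilize. At a
stable stage `cpMap A` does not enlarge the kernel, and irreducibility applies. -/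
theorem IsIrreducible.exists_pow_posDef {A : Fin d → Matrix m m ℂ} (hA : IsIrreducible A)
    {Z : Matrix m m ℂ} (hZ : Z.PosSemidef) (h0 : Z ≠ 0) :
    ∃ n : ℕ, (((1 + cpMap A) ^ n) Z).PosDef := by
  let f : ℕ → Matrix m m ℂ := fun n => ((1 + cpMap A) ^ n) Z
  have hf : ∀ n, f (n + 1) = f n + cpMap A (f n) := fun n => by
    simp only [f, pow_succ', Module.End.mul_apply, LinearMap.add_apply, Module.End.one_apply]
  have hpos : ∀ n, (f n).PosSemidef := by
    intro n
    induction n with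
    | zero => simpa [f] using hZ
    | succ n ih => rw [hf]; exact ih.add (posSemidef_cpMap A ih)
  have hle : ∀ n v, f (n + 1) *ᵥ v = 0 → f n *ᵥ v = 0 ∧ cpMap A (f n) *ᵥ v = 0 := by
    intro n v hv
    rw [hf] at hv
    exact mulVec_eq_zero_of_add (hpos n) (posSemidef_cpMap A (hpos n)) hv
  have hne : ∀ n, f n ≠ 0 := by
    intro n
    induction n with
    | zero => simpa [f] using h0
    | succ n ih =>
      classical
      intro h
      refine ih (Matrix.ext_of_mulVec_single fun i => ?_)
      rw [(hle n _ (by rw [h, Matrix.zero_mulVec])).1, Matrix.zero_mulVec]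
  let K : ℕ →o (Submodule ℂ (m → ℂ))ᵒᵈ :=
    ⟨fun n => OrderDual.toDual (LinearMap.ker (f n).mulVecLin),
      monotone_nat_of_le_succ fun n v hv => (hle n v hv).1⟩
  obtain ⟨n, hn⟩ := WellFoundedGT.monotone_chain_condition K
  refine ⟨n, hA.posDef_of_ker_le (hpos n) (hne n) fun v hv => (hle n v ?_).2⟩
  have : LinearMap.ker (f n).mulVecLin = LinearMap.ker (f (n + 1)).mulVecLin := hn (n + 1) n.le_succ
  have hv' : v ∈ LinearMap.ker (f n).mulVecLin := hv
  rw [this] at hv'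
  exact hv'

section

open scoped MatrixOrder Matrix.Norms.L2Operator

theorem exists_pos_sub_smul_posSemidef {P Y : Matrix m m ℂ} (hP : P.PosDef)
    (hY : Y.PosSemidef) : ∃ ε : ℝ, 0 < ε ∧ (P - (ε : ℂ) • Y).PosSemidef := by
  classical
  cases isEmpty_or_nonempty m
  · exact ⟨1, one_pos, by convert Matrix.PosSemidef.zero; exact Subsingleton.elim _ _⟩
  obtain ⟨r, hr, hrP⟩ := (CFC.exists_pos_algebraMap_le_iff hP.1).2 fun x hx =>
    hP.isStrictlyPositive.spectrum_pos hx
  have hYn : Y ≤ algebraMap ℝ _ ‖Y‖ := IsSelfAdjoint.le_algebraMap_norm_self hY.1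
  have hn : 0 < ‖Y‖ + 1 := by positivity
  -- Here `P ≥ r` and `Y ≤ ‖Y‖`; the `+ 1` covers `Y = 0`.
  refine ⟨r / (‖Y‖ + 1), div_pos hr hn, ?_⟩
  rw [← Matrix.nonneg_iff_posSemidef, sub_nonneg, Complex.coe_smul]
  refine le_trans ?_ hrP
  calc (r / (‖Y‖ + 1)) • Y ≤ (r / (‖Y‖ + 1)) • algebraMap ℝ (Matrix m m ℂ) (‖Y‖ + 1) := by
        refine smul_le_smul_of_nonneg_left (hYn.trans ?_) (by positivity)
        exact algebraMap_mono _ (by linarith)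
    _ = algebraMap ℝ _ r := by
        rw [Algebra.smul_def, ← map_mul, div_mul_cancel₀ _ hn.ne']

end

open scoped MatrixOrder in
theorem exists_eq_mul_conjTranspose [DecidableEq m] {X : Matrix m m ℂ} (hX : X.PosSemidef) :
    ∃ S : Matrix m m ℂ, X = S * Sᴴ := by
  obtain ⟨S, hS⟩ := CStarAlgebra.nonneg_iff_eq_star_mul_self.1 hX.nonneg
  exact ⟨Sᴴ, by rw [hS, Matrix.conjTranspose_conjTranspose, Matrix.star_eq_conjTranspose]⟩

theorem isClosed_posSemidef : IsClosed {X : Matrix m m ℂ | X.PosSemidef} := by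
  simp only [Matrix.posSemidef_iff_dotProduct_mulVec, Set.ofPred_and, Set.ofPred_forall]
  refine (isClosed_eq (by fun_prop) (by fun_prop)).inter (isClosed_iInter fun v => ?_)
  exact isClosed_le continuous_const (by fun_prop)

/-- Parametrizing the trace-one positive matrices as `S * Sᴴ` makes positivity automatic, and the
trace condition puts `S` on the Frobenius unit sphere. -/
theorem isCompact_trace_mul_conjTranspose_eq_one :
    IsCompact {S : Matrix m m ℂ | (S * Sᴴ).trace = 1} := by
  refine IsCompact.of_isClosed_subset (s := Set.univ.pi fun _ : m => Set.univ.pi fun _ : m =>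
    Metric.closedBall (0 : ℂ) 1) ?_ (isClosed_eq (by fun_prop) (by fun_prop)) ?_
  · exact isCompact_univ_pi fun _ => isCompact_univ_pi fun _ => isCompact_closedBall _ _
  · intro (S : Matrix m m ℂ) (hS : (S * Sᴴ).trace = 1) i _ j _
    have h : (∑ i, ∑ j, ‖S i j‖ ^ 2 : ℝ) = 1 := by
      have : (S * Sᴴ).trace = ((∑ i, ∑ j, ‖S i j‖ ^ 2 : ℝ) : ℂ) := by
        simp [Matrix.trace, Matrix.mul_apply, Complex.mul_conj, Complex.normSq_eq_norm_sq]
      exact_mod_cast this.symm.trans hS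
    rw [mem_closedBall_zero_iff]
    have h1 : ‖S i j‖ ^ 2 ≤ 1 := by
      rw [← h]
      exact (Finset.single_le_sum (f := fun j => ‖S i j‖ ^ 2) (fun _ _ => by positivity)
        (Finset.mem_univ j)).trans (Finset.single_le_sum (f := fun i => ∑ j, ‖S i j‖ ^ 2)
          (fun _ _ => by positivity) (Finset.mem_univ i))
    exact (sq_le_one_iff₀ (norm_nonneg _)).1 h1

/-- The Collatz–Wielandt number of a completely positive map is attained. -/
theorem exists_max_posSemidef_cpMap_sub_smul [Nonempty m] (A : Fin d → Matrix m m ℂ) :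
    ∃ (r : ℝ) (X : Matrix m m ℂ), 0 ≤ r ∧ X.PosSemidef ∧ X ≠ 0 ∧
      (cpMap A X - (r : ℂ) • X).PosSemidef ∧
      ∀ (t : ℝ) (Y : Matrix m m ℂ), Y.PosSemidef → Y ≠ 0 →
        (cpMap A Y - (t : ℂ) • Y).PosSemidef → t ≤ r := by
  classical
  have hE : Continuous fun X : Matrix m m ℂ => cpMap A X := by
    simp only [cpMap_apply]; fun_prop
  let C : Set (Matrix m m ℂ) := {S | (S * Sᴴ).trace = 1}
  have hC : IsCompact C := isCompact_trace_mul_conjTranspose_eq_one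
  have hEC : Continuous fun S : Matrix m m ℂ => cpMap A (S * Sᴴ) := hE.comp (by fun_prop)
  obtain ⟨M, hM⟩ := (hC.image (f := fun S => (cpMap A (S * Sᴴ)).trace.re) (by fun_prop)).bddAbove
  have hCscale : ∀ Y : Matrix m m ℂ, Y.PosSemidef → Y ≠ 0 →
      ∃ S ∈ C, ∃ z : ℝ, 0 < z ∧ S * Sᴴ = (z : ℂ) • Y := by
    intro Y hY hY0
    obtain ⟨y, hy⟩ : ∃ y : ℝ, Y.trace = y := ⟨Y.trace.re, by
      rw [Complex.ext_iff]; simpa using (Complex.nonneg_iff.1 hY.trace_nonneg).2.symm⟩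
    have hy0 : 0 < y := by
      have h1 : 0 ≤ y := by have := hY.trace_nonneg; rw [hy] at this; exact_mod_cast this
      refine h1.lt_of_ne' fun h => hY0 (hY.trace_eq_zero_iff.1 (by rw [hy, h]; simp))
    have hY' : ((y⁻¹ : ℝ) • Y).PosSemidef := hY.smul (by positivity)
    obtain ⟨S, hS⟩ := exists_eq_mul_conjTranspose hY'
    refine ⟨S, ?_, y⁻¹, inv_pos.2 hy0, by rw [← hS, Complex.coe_smul]⟩
    change (S * Sᴴ).trace = 1
    rw [← hS, Matrix.trace_smul, hy, Complex.real_smul, ← Complex.ofReal_mul,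
      inv_mul_cancel₀ hy0.ne', Complex.ofReal_one]
  have hbound : ∀ S ∈ C, ∀ t : ℝ, (cpMap A (S * Sᴴ) - (t : ℂ) • (S * Sᴴ)).PosSemidef → t ≤ M := by
    intro S hS t ht
    have h1 := (Complex.nonneg_iff.1 ht.trace_nonneg).1
    have h2 : (S * Sᴴ).trace = 1 := hS
    rw [Matrix.trace_sub, Matrix.trace_smul, h2] at h1
    have h3 := hM (Set.mem_image_of_mem _ hS)
    simp at h1 h3
    linarith
  -- The number `r` is the largest first coordinate on this compact set; the bound `M` on `t` comes
  -- from taking traces.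
  let K : Set (ℝ × Matrix m m ℂ) := (Set.Icc 0 M ×ˢ C) ∩
    {p | (cpMap A (p.2 * p.2ᴴ) - (p.1 : ℂ) • (p.2 * p.2ᴴ)).PosSemidef}
  have hK : IsCompact K := by
    refine (isCompact_Icc.prod hC).inter_right (isClosed_posSemidef.preimage ?_)
    exact (hEC.comp continuous_snd).sub (by fun_prop)
  have hKne : K.Nonempty := by
    obtain ⟨S, hS, -⟩ := hCscale 1 Matrix.PosSemidef.one one_ne_zero
    have h0 : (cpMap A (S * Sᴴ) - ((0 : ℝ) : ℂ) • (S * Sᴴ)).PosSemidef := by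
      simpa using posSemidef_cpMap A (Matrix.posSemidef_self_mul_conjTranspose S)
    exact ⟨(0, S), ⟨⟨le_rfl, hbound S hS 0 h0⟩, hS⟩, h0⟩
  obtain ⟨⟨r, S⟩, ⟨⟨hr, hS⟩, hrS⟩, hmax⟩ := hK.exists_isMaxOn hKne continuous_fst.continuousOn
  refine ⟨r, S * Sᴴ, hr.1, Matrix.posSemidef_self_mul_conjTranspose S, fun h => ?_, hrS, ?_⟩
  · have h2 : (S * Sᴴ).trace = 1 := hS
    simp [h] at h2
  · intro t Y hY hY0 ht
    rcases lt_or_ge t 0 with ht0 | ht0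
    · exact ht0.le.trans hr.1
    obtain ⟨T, hT, z, hz, hTz⟩ := hCscale Y hY hY0
    have hTt : (cpMap A (T * Tᴴ) - (t : ℂ) • (T * Tᴴ)).PosSemidef := by
      have := ht.smul hz.le
      rw [hTz, map_smul, smul_comm (t : ℂ), ← smul_sub, Complex.coe_smul]
      exact this
    exact hmax (a := (t, T)) ⟨⟨⟨ht0, hbound T hT t hTt⟩, hT⟩, hTt⟩

theorem IsIrreducible.exists_posDef_eigenvector [Nonempty m] {A : Fin d → Matrix m m ℂ}
    (hA : IsIrreducible A) :
    ∃ (r : ℝ) (X : Matrix m m ℂ), 0 ≤ r ∧ X.PosDef ∧ cpMap A X = (r : ℂ) • X := by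
  obtain ⟨r, X, hr, hX, hX0, hZ, hmax⟩ := exists_max_posSemidef_cpMap_sub_smul A
  have hEX : cpMap A X = (r : ℂ) • X := by
    by_contra hne
    obtain ⟨n, hn⟩ := hA.exists_pow_posDef hZ (sub_ne_zero.2 hne)
    have hcomm : ∀ V, cpMap A (((1 + cpMap A) ^ n) V) = ((1 + cpMap A) ^ n) (cpMap A V) := by
      intro V
      have : Commute (cpMap A) ((1 + cpMap A) ^ n) :=
        ((Commute.one_right _).add_right (Commute.refl _)).pow_right n
      exact LinearMap.congr_fun this.eq V
    rw [map_sub, map_smul, ← hcomm] at hn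
    set Y := ((1 + cpMap A) ^ n) X with hYdef
    have hY : Y.PosSemidef := by
      rw [hYdef]
      clear_value Y
      clear hYdef hn hcomm
      induction n with
      | zero => simpa using hX
      | succ n ih =>
        rw [pow_succ', Module.End.mul_apply, LinearMap.add_apply, Module.End.one_apply]
        exact ih.add (posSemidef_cpMap A ih)
    have hY0 : Y ≠ 0 := by
      intro h
      rw [h] at hn
      have := hn.trace_pos
      simp at this
    obtain ⟨ε, hε, h⟩ := exists_pos_sub_smul_posSemidef hn hY
    have := hmax (r + ε) Y hY hY0 (by
      convert h using 1
      push_cast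
      rw [add_smul, sub_sub])
    linarith
  refine ⟨r, X, hr, hA.posDef_of_ker_le hX hX0 fun v hv => ?_, hEX⟩
  rw [hEX, Matrix.smul_mulVec, hv, smul_zero]

end

section

variable {d : ℕ} {m : Type*} [Fintype m] [DecidableEq m]

/-! ### The canonical form of an irreducible family -/

/-- For a fixed point `X` of a unital map, the Schwarz defect `cpMap A (X * Xᴴ) - X * Xᴴ` is the sum
of the `K * Kᴴ` over the commutators `K` of `X` with the `A i`. Its trace against the dual fixed
point `Y` is zero, and `Y` is positive definite, so `X` commutes with the family. -/
theorem IsIrreducible.fixed_unique {A : Fin d → Matrix m m ℂ} (hA : IsIrreducible A)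
    (h1 : ∑ i, A i * (A i)ᴴ = 1) {Y : Matrix m m ℂ} (hY : Y.PosDef)
    (hYA : ∑ i, (A i)ᴴ * Y * A i = Y) {X : Matrix m m ℂ} (hX : cpMap A X = X) :
    ∃ z : ℂ, X = z • (1 : Matrix m m ℂ) := by
  obtain ⟨T, hT⟩ := exists_eq_mul_conjTranspose hY.posSemidef
  have hTu : IsUnit Tᴴ := by
    have := hY.isUnit
    rw [Matrix.isUnit_iff_isUnit_det, hT, Matrix.det_mul] at this
    rw [Matrix.isUnit_iff_isUnit_det]
    exact isUnit_of_mul_isUnit_right this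
  have hX' : ∑ i, A i * Xᴴ * (A i)ᴴ = Xᴴ := by
    have := congrArg Matrix.conjTranspose hX
    rw [cpMap_apply, Matrix.conjTranspose_sum] at this
    simpa only [Matrix.conjTranspose_mul, Matrix.conjTranspose_conjTranspose, Matrix.mul_assoc]
      using this
  have hsum : ∑ i, (X * A i - A i * X) * (X * A i - A i * X)ᴴ = cpMap A (X * Xᴴ) - X * Xᴴ := by
    have e : ∀ i, (X * A i - A i * X) * (X * A i - A i * X)ᴴ =
        X * (A i * (A i)ᴴ) * Xᴴ - X * (A i * Xᴴ * (A i)ᴴ) - (A i * X * (A i)ᴴ) * Xᴴ +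
          A i * (X * Xᴴ) * (A i)ᴴ := by
      intro i
      rw [Matrix.conjTranspose_sub, Matrix.conjTranspose_mul, Matrix.conjTranspose_mul]
      noncomm_ring
    simp only [e, Finset.sum_add_distrib, Finset.sum_sub_distrib, ← Matrix.mul_sum,
      ← Matrix.sum_mul, h1, hX', ← cpMap_apply, hX, Matrix.mul_one, sub_self, zero_sub]
    exact neg_add_eq_sub _ _
  have htr : (Y * cpMap A (X * Xᴴ)).trace = (Y * (X * Xᴴ)).trace := by
    conv_rhs => rw [← hYA]
    rw [cpMap_apply, Matrix.mul_sum, Matrix.sum_mul, Matrix.trace_sum, Matrix.trace_sum]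
    refine Finset.sum_congr rfl fun i _ => ?_
    rw [← Matrix.mul_assoc, Matrix.trace_mul_comm]
    simp only [Matrix.mul_assoc]
  have h0 : ∑ i, ((Tᴴ * (X * A i - A i * X)) * (Tᴴ * (X * A i - A i * X))ᴴ).trace = 0 := by
    calc _ = ∑ i, (Y * ((X * A i - A i * X) * (X * A i - A i * X)ᴴ)).trace := by
          refine Finset.sum_congr rfl fun i _ => ?_
          rw [Matrix.conjTranspose_mul, Matrix.conjTranspose_conjTranspose, hT, Matrix.mul_assoc T,
            Matrix.trace_mul_comm T]
          simp only [Matrix.mul_assoc]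
      _ = 0 := by
          rw [← Matrix.trace_sum, ← Matrix.mul_sum, hsum, Matrix.mul_sub, Matrix.trace_sub, htr,
            sub_self]
  rw [Finset.sum_eq_zero_iff_of_nonneg fun i _ =>
    (Matrix.posSemidef_self_mul_conjTranspose _).trace_nonneg] at h0
  refine hA.eq_smul_one_of_commute fun i => sub_eq_zero.1 ?_
  have := Matrix.trace_mul_conjTranspose_self_eq_zero_iff.1 (h0 i (Finset.mem_univ i))
  exact hTu.mul_left_cancel (this.trans (Matrix.mul_zero _).symm)

/-- The dual of a unital map preserves the trace, which forces its Perron eigenvalue to be `1`. -/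
theorem IsIrreducible.exists_posDef_dual_fixed [Nonempty m] {A : Fin d → Matrix m m ℂ}
    (hA : IsIrreducible A) (h1 : ∑ i, A i * (A i)ᴴ = 1) :
    ∃ Y : Matrix m m ℂ, Y.PosDef ∧ ∑ i, (A i)ᴴ * Y * A i = Y := by
  obtain ⟨r, Y, -, hY, hr⟩ := hA.conjTranspose.exists_posDef_eigenvector
  simp only [cpMap_apply, Matrix.conjTranspose_conjTranspose] at hr
  have htr := congrArg Matrix.trace hr
  have e : (∑ i, (A i)ᴴ * Y * A i).trace = Y.trace := by
    calc _ = (Y * ∑ i, A i * (A i)ᴴ).trace := by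
          rw [Matrix.mul_sum, Matrix.trace_sum, Matrix.trace_sum]
          refine Finset.sum_congr rfl fun i _ => ?_
          rw [Matrix.trace_mul_cycle, Matrix.trace_mul_comm]
      _ = _ := by rw [h1, Matrix.mul_one]
  rw [e, Matrix.trace_smul, smul_eq_mul] at htr
  have : (r : ℂ) = 1 := mul_right_cancel₀ hY.trace_pos.ne' (by rw [← htr, one_mul])
  exact ⟨Y, hY, by rw [hr, this, one_smul]⟩

theorem IsIrreducible.exists_isCanonicalBlock_of_unital [Nonempty m] {A : Fin d → Matrix m m ℂ}
    (hA : IsIrreducible A) (h1 : ∑ i, A i * (A i)ᴴ = 1) :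
    ∃ U : Matrix m m ℂ, U * Uᴴ = 1 ∧ IsCanonicalBlock fun i => Uᴴ * A i * U := by
  obtain ⟨Y, hY, hYA⟩ := hA.exists_posDef_dual_fixed h1
  let U : Matrix m m ℂ := hY.1.eigenvectorUnitary
  have hU : U * Uᴴ = 1 := Unitary.coe_mul_star_self hY.1.eigenvectorUnitary
  have hU' : Uᴴ * U = 1 := mul_eq_one_comm.1 hU
  let v := hY.1.eigenvalues
  have hv : ∀ i, 0 < v i := hY.eigenvalues_pos
  have hYU : Y = U * Matrix.diagonal (fun k => (v k : ℂ)) * Uᴴ := hY.1.spectral_theorem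
  have hYU' : Uᴴ * Y * U = Matrix.diagonal (fun k => (v k : ℂ)) := by
    calc Uᴴ * Y * U = (Uᴴ * U) * Matrix.diagonal (fun k => (v k : ℂ)) * (Uᴴ * U) := by
          rw [hYU]; simp only [Matrix.mul_assoc]
      _ = _ := by rw [hU', Matrix.one_mul, Matrix.mul_one]
  have hB : IsIrreducible fun i => Uᴴ * A i * U := by
    refine hA.of_similar (c := 1) hU fun i => ?_
    rw [one_smul]
    calc A i = (U * Uᴴ) * A i * (U * Uᴴ) := by rw [hU, Matrix.one_mul, Matrix.mul_one]
      _ = _ := by simp only [Matrix.mul_assoc]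
  have hun : ∑ i, (Uᴴ * A i * U) * (Uᴴ * A i * U)ᴴ = 1 := by
    calc _ = ∑ i, Uᴴ * (A i * (U * Uᴴ) * (A i)ᴴ) * U := by
          simp only [Matrix.conjTranspose_mul, Matrix.conjTranspose_conjTranspose, Matrix.mul_assoc]
      _ = 1 := by
          simp only [hU, Matrix.mul_one]
          rw [← Matrix.sum_mul, ← Matrix.mul_sum, h1, Matrix.mul_one, hU']
  have hdual : ∑ i, (Uᴴ * A i * U)ᴴ * Matrix.diagonal (fun k => (v k : ℂ)) * (Uᴴ * A i * U) =
      Matrix.diagonal (fun k => (v k : ℂ)) := by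
    calc _ = ∑ i, Uᴴ * ((A i)ᴴ * (U * Matrix.diagonal (fun k => (v k : ℂ)) * Uᴴ) * A i) * U := by
          simp only [Matrix.conjTranspose_mul, Matrix.conjTranspose_conjTranspose, Matrix.mul_assoc]
      _ = _ := by
          rw [← hYU, ← Matrix.sum_mul, ← Matrix.mul_sum, hYA, hYU']
  exact ⟨U, hU, hun, ⟨v, hv, hdual⟩, fun X hX => hB.fixed_unique hun
    (Matrix.PosDef.diagonal fun i => by exact_mod_cast hv i) hdual hX⟩

/-- An irreducible nonzero family is, up to a positive scalar and a similarity, a canonical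
block. -/
theorem IsIrreducible.exists_isCanonicalBlock {A : Fin d → Matrix m m ℂ}
    (hA : IsIrreducible A) (h0 : ∃ i, A i ≠ 0) :
    ∃ (lam : ℝ) (B : Fin d → Matrix m m ℂ) (S S' : Matrix m m ℂ), 0 < lam ∧ S * S' = 1 ∧
      (∀ i, A i = (lam : ℂ) • (S * B i * S')) ∧ IsCanonicalBlock B ∧
      ((lam ^ 2 : ℝ) : ℂ) ∈ spectrum ℂ (cpMap A) := by
  obtain ⟨i₀, hi₀⟩ := h0
  have : Nonempty m := by
    by_contra h
    rw [not_nonempty_iff] at h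
    exact hi₀ (Subsingleton.elim _ _)
  obtain ⟨r, X, hr, hX, hrX⟩ := hA.exists_posDef_eigenvector
  obtain ⟨T, hT⟩ := exists_eq_mul_conjTranspose hX.posSemidef
  have hTu : IsUnit T.det := by
    have := hX.isUnit
    rw [Matrix.isUnit_iff_isUnit_det, hT, Matrix.det_mul] at this
    exact isUnit_of_mul_isUnit_left this
  have hTT : T * T⁻¹ = 1 := Matrix.mul_nonsing_inv T hTu
  have hTT' : T⁻¹ * T = 1 := Matrix.nonsing_inv_mul T hTu
  -- If `r = 0`, the squared Frobenius norms of the `A i * T` sum to zero; as `T` is invertible, the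
  -- family would vanish.
  have hr0 : r ≠ 0 := by
    rintro rfl
    refine hi₀ ?_
    have htr : ∑ i, ((A i * T) * (A i * T)ᴴ).trace = 0 := by
      rw [← Matrix.trace_sum]
      have : ∑ i, (A i * T) * (A i * T)ᴴ = cpMap A X := by
        simp only [cpMap_apply, hT, Matrix.conjTranspose_mul, Matrix.mul_assoc]
      rw [this, hrX]
      simp
    rw [Finset.sum_eq_zero_iff_of_nonneg fun i _ =>
      (Matrix.posSemidef_self_mul_conjTranspose _).trace_nonneg] at htr
    have := Matrix.trace_mul_conjTranspose_self_eq_zero_iff.1 (htr i₀ (Finset.mem_univ _))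
    rw [← Matrix.mul_one (A i₀), ← hTT, ← Matrix.mul_assoc, this, Matrix.zero_mul]
  have hrpos : 0 < r := hr.lt_of_ne' hr0
  have hsq : ((√r : ℝ) : ℂ) * ((√r : ℝ) : ℂ) = r := by
    rw [← Complex.ofReal_mul, Real.mul_self_sqrt hr]
  have hs0 : ((√r : ℝ) : ℂ) ≠ 0 := by
    rw [Complex.ofReal_ne_zero]; exact (Real.sqrt_pos.2 hrpos).ne'
  let C : Fin d → Matrix m m ℂ := fun i => ((√r : ℝ) : ℂ)⁻¹ • (T⁻¹ * A i * T)
  have hAC : ∀ i, A i = ((√r : ℝ) : ℂ) • (T * C i * T⁻¹) := by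
    intro i
    simp only [C, Matrix.mul_smul, Matrix.smul_mul, smul_smul]
    rw [mul_inv_cancel₀ hs0, one_smul]
    calc A i = (T * T⁻¹) * A i * (T * T⁻¹) := by rw [hTT, Matrix.one_mul, Matrix.mul_one]
      _ = _ := by simp only [Matrix.mul_assoc]
  have hC1 : ∑ i, C i * (C i)ᴴ = 1 := by
    have e : ∀ i, C i * (C i)ᴴ = (r : ℂ)⁻¹ • (T⁻¹ * (A i * X * (A i)ᴴ) * (T⁻¹)ᴴ) := by
      intro i
      simp only [C, Matrix.conjTranspose_smul, Matrix.mul_smul, Matrix.smul_mul, smul_smul,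
        Matrix.conjTranspose_mul, hT, Matrix.mul_assoc]
      congr 1
      rw [← hsq]
      simp
    simp only [e]
    rw [← Finset.smul_sum, ← Matrix.sum_mul, ← Matrix.mul_sum, ← cpMap_apply, hrX, Matrix.mul_smul,
      Matrix.smul_mul, smul_smul, inv_mul_cancel₀ (Complex.ofReal_ne_zero.2 hr0), one_smul, hT]
    calc T⁻¹ * (T * Tᴴ) * (T⁻¹)ᴴ = (T⁻¹ * T) * (T⁻¹ * T)ᴴ := by
          rw [Matrix.conjTranspose_mul]; simp only [Matrix.mul_assoc]
      _ = 1 := by rw [hTT']; simp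
  obtain ⟨U, hU, hB⟩ := (hA.of_similar hTT hAC).exists_isCanonicalBlock_of_unital hC1
  refine ⟨√r, _, T * U, Uᴴ * T⁻¹, Real.sqrt_pos.2 hrpos, ?_, fun i => ?_, hB, ?_⟩
  · calc T * U * (Uᴴ * T⁻¹) = T * (U * Uᴴ) * T⁻¹ := by simp only [Matrix.mul_assoc]
      _ = 1 := by rw [hU, Matrix.mul_one, hTT]
  · rw [hAC i]
    congr 1
    calc T * C i * T⁻¹ = T * ((U * Uᴴ) * C i * (U * Uᴴ)) * T⁻¹ := by
          rw [hU, Matrix.one_mul, Matrix.mul_one]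
      _ = _ := by simp only [Matrix.mul_assoc]
  · rw [mem_spectrum_cpMap_iff, Real.sq_sqrt hr]
    refine ⟨X, fun h => ?_, hrX⟩
    have := hX.trace_pos
    simp [h] at this

/-! ### Block triangular form of a reducible family -/

theorem spectrum_cpMap_subset_fromBlocks₁₁ {p q : Type*} [Fintype p] [Fintype q] [DecidableEq p]
    (P : Fin d → Matrix p p ℂ) (Q : Fin d → Matrix p q ℂ) (R : Fin d → Matrix q q ℂ) :
    spectrum ℂ (cpMap P) ⊆ spectrum ℂ (cpMap fun i => Matrix.fromBlocks (P i) (Q i) 0 (R i)) := by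
  refine spectrum_cpMap_subset_of_injective
    (V := Matrix.fromRows (1 : Matrix p p ℂ) (0 : Matrix q p ℂ))
    (V' := Matrix.fromCols (1 : Matrix p p ℂ) (0 : Matrix p q ℂ)) ?_ fun i => ?_
  · simp [Matrix.fromCols_mul_fromRows]
  · simp [Matrix.fromBlocks_mul_fromRows, Matrix.fromRows_mul]

theorem spectrum_cpMap_subset_fromBlocks₂₂ {p q : Type*} [Fintype p] [Fintype q] [DecidableEq q]
    (P : Fin d → Matrix p p ℂ) (Q : Fin d → Matrix p q ℂ) (R : Fin d → Matrix q q ℂ) :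
    spectrum ℂ (cpMap R) ⊆ spectrum ℂ (cpMap fun i => Matrix.fromBlocks (P i) (Q i) 0 (R i)) := by
  refine spectrum_cpMap_subset_of_surjective
    (W := Matrix.fromCols (0 : Matrix q p ℂ) (1 : Matrix q q ℂ))
    (W' := Matrix.fromRows (0 : Matrix p q ℂ) (1 : Matrix q q ℂ)) ?_ fun i => ?_
  · simp [Matrix.fromCols_mul_fromRows]
  · simp [Matrix.fromCols_mul_fromBlocks, Matrix.mul_fromCols]

/-- A family of matrices with a nontrivial invariant subspace is similar to a block triangular
one. -/
theorem exists_fromBlocks_of_not_isIrreducible {D : ℕ} {A : Fin d → Matrix (Fin D) (Fin D) ℂ}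
    (hA : ¬ IsIrreducible A) :
    ∃ (p q : ℕ) (S : Matrix (Fin D) (Fin p ⊕ Fin q) ℂ) (S' : Matrix (Fin p ⊕ Fin q) (Fin D) ℂ)
      (P : Fin d → Matrix (Fin p) (Fin p) ℂ) (Q : Fin d → Matrix (Fin p) (Fin q) ℂ)
      (R : Fin d → Matrix (Fin q) (Fin q) ℂ),
      p < D ∧ q < D ∧ p + q = D ∧ S * S' = 1 ∧ S' * S = 1 ∧
      ∀ i, S' * A i * S = Matrix.fromBlocks (P i) (Q i) 0 (R i) := by
  simp only [IsIrreducible, not_forall, not_or] at hA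
  obtain ⟨W, hW, hbot, htop⟩ := hA
  obtain ⟨W', hWW'⟩ := W.exists_isCompl
  have hsum := Submodule.finrank_add_eq_of_isCompl hWW'
  rw [Module.finrank_fin_fun] at hsum
  have hp : 0 < Module.finrank ℂ W := by
    rw [Nat.pos_iff_ne_zero, Ne, Submodule.finrank_eq_zero]; exact hbot
  have hq : 0 < Module.finrank ℂ W' := by
    rw [Nat.pos_iff_ne_zero, Ne, Submodule.finrank_eq_zero]
    rintro rfl
    exact htop (by simpa using hWW'.sup_eq_top)
  -- A basis adapted to `W ⊕ W'`: invariance of `W` kills the lower left blocks.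
  let b : Module.Basis (Fin (Module.finrank ℂ W) ⊕ Fin (Module.finrank ℂ W')) ℂ (Fin D → ℂ) :=
    ((Module.finBasis ℂ W).prod (Module.finBasis ℂ W')).map
      (Submodule.prodEquivOfIsCompl W W' hWW')
  let e := Pi.basisFun ℂ (Fin D)
  let M := fun i => LinearMap.toMatrix b b (Matrix.toLin' (A i))
  have hM : ∀ i, b.toMatrix e * A i * e.toMatrix b = M i := by
    intro i
    have := basis_toMatrix_mul_linearMap_toMatrix_mul_basis_toMatrix b e b e (Matrix.toLin' (A i))
    refine Eq.trans ?_ this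
    congr 2
    simp [e, LinearMap.toMatrix_eq_toMatrix']
  refine ⟨_, _, e.toMatrix b, b.toMatrix e, fun i => (M i).toBlocks₁₁, fun i => (M i).toBlocks₁₂,
    fun i => (M i).toBlocks₂₂, by omega, by omega, hsum, e.toMatrix_mul_toMatrix_flip b,
    b.toMatrix_mul_toMatrix_flip e, fun i => ?_⟩
  rw [hM]
  have h21 : (M i).toBlocks₂₁ = 0 := by
    ext j k
    have hk : b (Sum.inl k) = (Module.finBasis ℂ W k : Fin D → ℂ) := by
      simp only [b, Module.Basis.map_apply, Module.Basis.prod_apply, Sum.elim_inl,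
        Function.comp_apply, LinearMap.inl_apply, Submodule.coe_prodEquivOfIsCompl',
        ZeroMemClass.coe_zero, add_zero]
    have hmem : A i *ᵥ b (Sum.inl k) ∈ W := hW i _ (by rw [hk]; exact Subtype.coe_prop _)
    simp only [M, Matrix.toBlocks₂₁, Matrix.of_apply, LinearMap.toMatrix_apply, Matrix.toLin'_apply,
      Matrix.zero_apply]
    have : (Submodule.prodEquivOfIsCompl W W' hWW').symm (A i *ᵥ b (Sum.inl k)) =
        (⟨_, hmem⟩, 0) :=
      Submodule.prodEquivOfIsCompl_symm_apply_left W W' hWW' ⟨_, hmem⟩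
    simp only [b, Module.Basis.map_repr, LinearEquiv.trans_apply] at this ⊢
    rw [this]
    simp
  rw [← h21, Matrix.fromBlocks_toBlocks]

/-! ### The canonical form -/

/-- A weighted block: a size, a weight and a family of matrices. -/
abbrev WeightedBlock (d : ℕ) := (n : ℕ) × ℝ × (Fin d → Matrix (Fin n) (Fin n) ℂ)

/-- Every family generates the same matrix product vectors as a list of weighted canonical blocks,
the squared weights being in the spectrum of the completely positive map. -/
theorem exists_weightedBlocks (D : ℕ) (A : Fin d → Matrix (Fin D) (Fin D) ℂ) :
    ∃ L : List (WeightedBlock d),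
      (∀ x ∈ L, 0 < x.1 ∧ 0 < x.2.1 ∧ IsCanonicalBlock x.2.2 ∧
        ((x.2.1 ^ 2 : ℝ) : ℂ) ∈ spectrum ℂ (cpMap A)) ∧
      (L.map fun x => x.1).sum ≤ D ∧
      ∀ N, 1 ≤ N → ∀ s : Fin N → Fin d,
        tiVector A N s = (L.map fun x => (x.2.1 : ℂ) ^ N * tiVector x.2.2 N s).sum := by
  induction D using Nat.strong_induction_on with
  | _ D ih =>
  by_cases hA : IsIrreducible A
  · by_cases h0 : ∃ i, A i ≠ 0
    · obtain ⟨lam, B, S, S', hlam, hS, hAB, hB, hspec⟩ := hA.exists_isCanonicalBlock h0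
      have hD : 0 < D := by
        obtain ⟨i, hi⟩ := h0
        rcases Nat.eq_zero_or_pos D with rfl | h
        · exact absurd (Subsingleton.elim _ _) hi
        · exact h
      refine ⟨[⟨D, lam, B⟩], by simpa using ⟨hD, hlam, hB, by simpa using hspec⟩, by simp,
        fun N _ s => ?_⟩
      simpa using tiVector_similar hS (mul_eq_one_comm.1 hS) hAB N s
    -- The zero family needs no block. This uses `N ≥ 1`: at `N = 0` the empty product has trace
    -- `D`.
    · push Not at h0
      refine ⟨[], by simp, by simp, fun N hN s => ?_⟩
      obtain ⟨N, rfl⟩ := Nat.exists_eq_add_of_le' hN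
      simp [tiVector, h0]
  · obtain ⟨p, q, S, S', P, Q, R, hp, hq, hpq, hS, hS', hblock⟩ :=
      exists_fromBlocks_of_not_isIrreducible hA
    obtain ⟨L₁, h₁, hs₁, ht₁⟩ := ih p hp P
    obtain ⟨L₂, h₂, hs₂, ht₂⟩ := ih q hq R
    have hAS : ∀ i, A i = (1 : ℂ) • (S * Matrix.fromBlocks (P i) (Q i) 0 (R i) * S') := by
      intro i
      rw [← hblock, one_smul]
      calc A i = (S * S') * A i * (S * S') := by rw [hS, Matrix.one_mul, Matrix.mul_one]
        _ = _ := by simp only [Matrix.mul_assoc]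
    have hspec : spectrum ℂ (cpMap fun i => Matrix.fromBlocks (P i) (Q i) 0 (R i)) ⊆
        spectrum ℂ (cpMap A) := by
      refine spectrum_cpMap_subset_of_injective hS' fun i => ?_
      rw [hAS i, one_smul, Matrix.mul_assoc, hS', Matrix.mul_one]
    have hspecP := (spectrum_cpMap_subset_fromBlocks₁₁ P Q R).trans hspec
    have hspecR := (spectrum_cpMap_subset_fromBlocks₂₂ P Q R).trans hspec
    refine ⟨L₁ ++ L₂, fun x hx => ?_, ?_, fun N hN s => ?_⟩
    · rcases List.mem_append.1 hx with hx | hx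
      · obtain ⟨a, b, c, e⟩ := h₁ x hx
        exact ⟨a, b, c, hspecP e⟩
      · obtain ⟨a, b, c, e⟩ := h₂ x hx
        exact ⟨a, b, c, hspecR e⟩
    · rw [List.map_append, List.sum_append]
      omega
    · rw [List.map_append, List.sum_append, ← ht₁ N hN s, ← ht₂ N hN s,
        ← tiVector_fromBlocks P Q R, tiVector_similar hS hS' hAS, one_pow, one_mul]

end

end MPS

theorem theorem4 (d D : ℕ) (A : Fin d → Matrix (Fin D) (Fin D) ℂ) :
    ∃ (c : ℝ) (b : ℕ) (n : Fin b → ℕ) (lam : Fin b → ℝ)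
      (B : (j : Fin b) → Fin d → Matrix (Fin (n j)) (Fin (n j)) ℂ),
      0 < c ∧
      (spectralRadius ℂ (MPS.cpMap A) ≠ 0 →
        spectralRadius ℂ (MPS.cpMap A) = ENNReal.ofReal (c ^ 2)) ∧
      (∀ j, 0 < n j) ∧
      (∀ j, 0 < lam j ∧ lam j ≤ 1) ∧
      (∀ j, MPS.IsCanonicalBlock (B j)) ∧
      ∑ j, n j ≤ D ∧
      (∀ N : ℕ, 1 ≤ N →
        MPS.tiVector A N = ((c : ℂ) ^ N) • MPS.tiVector (MPS.blockSum n lam B) N) := by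
  obtain ⟨L, hL, hsum, htr⟩ := MPS.exists_weightedBlocks D A
  have hfin : spectralRadius ℂ (MPS.cpMap A) ≠ ⊤ := by
    have hf : (spectrum ℂ (MPS.cpMap A)).Finite := Module.End.finite_spectrum _
    obtain ⟨M, hM⟩ := (hf.image fun z => ‖z‖₊).bddAbove
    refine ne_top_of_le_ne_top (ENNReal.coe_ne_top (r := M)) (iSup₂_le fun z hz => ?_)
    exact ENNReal.coe_le_coe.2 (hM (Set.mem_image_of_mem _ hz))
  have hle : ∀ x ∈ L, ENNReal.ofReal (x.2.1 ^ 2) ≤ spectralRadius ℂ (MPS.cpMap A) := by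
    intro x hx
    refine le_trans (le_of_eq ?_) (le_iSup₂ (f := fun (k : ℂ) (_ : k ∈ spectrum ℂ (MPS.cpMap A)) =>
      (‖k‖₊ : ENNReal)) _ (hL x hx).2.2.2)
    rw [← enorm_eq_nnnorm, ← ofReal_norm, Complex.norm_real,
      Real.norm_of_nonneg (sq_nonneg _)]
  obtain ⟨c, hc, hcspec, hcL⟩ : ∃ c : ℝ, 0 < c ∧
      (spectralRadius ℂ (MPS.cpMap A) ≠ 0 →
        spectralRadius ℂ (MPS.cpMap A) = ENNReal.ofReal (c ^ 2)) ∧ ∀ x ∈ L, x.2.1 ≤ c := by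
    by_cases h : spectralRadius ℂ (MPS.cpMap A) = 0
    -- No blocks occur here, since a weight would have positive square at most `0`; any `c > 0`
    -- would do.
    · refine ⟨1, one_pos, fun h' => absurd h h', fun x hx => ?_⟩
      have h1 := hle x hx
      have h2 := (hL x hx).2.1
      rw [h, nonpos_iff_eq_zero, ENNReal.ofReal_eq_zero] at h1
      exact absurd h1 (pow_pos h2 2).not_ge
    · have hpos := ENNReal.toReal_pos h hfin
      have hsq := Real.sq_sqrt hpos.le
      refine ⟨_, Real.sqrt_pos.2 hpos, fun _ => by rw [hsq, ENNReal.ofReal_toReal hfin],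
        fun x hx => Real.le_sqrt_of_sq_le ?_⟩
      exact (ENNReal.ofReal_le_iff_le_toReal hfin).1 (hle x hx)
  refine ⟨c, L.length, fun j => (L.get j).1, fun j => (L.get j).2.1 / c, fun j => (L.get j).2.2, hc,
    hcspec, fun j => (hL _ (L.get_mem j)).1, fun j => ⟨div_pos (hL _ (L.get_mem j)).2.1 hc,
    (div_le_one hc).2 (hcL _ (L.get_mem j))⟩, fun j => (hL _ (L.get_mem j)).2.2.1, ?_,
    fun N hN => ?_⟩
  · rwa [← List.ofFn_get L, List.map_ofFn, List.sum_ofFn] at hsum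
  · ext s
    rw [Pi.smul_apply, MPS.tiVector_blockSum, htr N hN s, smul_eq_mul, Finset.mul_sum]
    conv_lhs => rw [← List.ofFn_get L, List.map_ofFn, List.sum_ofFn]
    refine Finset.sum_congr rfl fun j _ => ?_
    have hc' : (c : ℂ) ≠ 0 := Complex.ofReal_ne_zero.2 hc.ne'
    rw [← mul_assoc, ← mul_pow, Complex.ofReal_div, mul_div_cancel₀ _ hc', Function.comp_apply]
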